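/- Let $(X,d)$ be a finite metric space and $r\in X$ a root. For a set of terminals $T\subseteq X$ let $c_{X,r}(T)$ be the minimum length of a Steiner tree, that is, of a tree $S$ whose vertices are points of $X$ with $r\in V(S)$ and $T\subseteq V(S)$, where the length of $S$ is $\sum_{\{x,y\}\in E(S)} d(x,y)$. A function $g:2^X\to\mathbb{R}$ is submodular if $g(A)+g(B)\ge g(A\cup B)+g(A\cap B)$ for all $A,B\subseteq X$. The submodularity gap $SG(f)$ of $f:2^X\to\mathbb{R}_{\ge 0}$ is the infimum of all real $\lambda\ge 0$ for which there is a submodular $g:2^X\to\mathbb{R}$ with $f(S)\le g(S)\le\lambda f(S)$ for all $S\subseteq X$ (and $+\infty$ if there is no such $\lambda$). For $n\ge 1$ let $$SG(ST)_n=\sup\{SG(c_{X,r}) : (X,d)\text{ a metric space with exactly } n \text{ points},\ r\in X\}.$$ **Theorem.** The submodularity gap of Steiner tree is $SG(ST)_n=\Theta(\log n)$: there are absolute constants $c,C>0$ such that $c\log n\le SG(ST)_n\le C\log n$ for all integers $n\ge 2$. -/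

import Mathlib

open scoped ENNReal NNReal

noncomputable section

/-- The length of an edge of the complete graph on a metric space: the distance of its ends. -/
def edgeLength {X : Type*} [MetricSpace X] (e : Sym2 X) : ℝ :=
  Sym2.lift ⟨fun x y => dist x y, dist_comm⟩ e

/-- The length of a graph `S` drawn in a metric space `X` (a subgraph of the complete graph
on `X`): the sum of the lengths of its edges. It is used for finite `X` only. -/
def treeLength {X : Type*} [MetricSpace X] (S : (⊤ : SimpleGraph X).Subgraph) : ℝ :=
  ∑ᶠ e ∈ S.edgeSet, edgeLength e

/-- `S` is a feasible solution of the Steiner tree instance with root `r` and terminal set `T`: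
a tree in the metric space whose vertex set contains the root and all terminals
(and possibly further points of the space). -/
def IsSteinerTree {X : Type*} (r : X) (T : Set X) (S : (⊤ : SimpleGraph X).Subgraph) : Prop :=
  S.coe.IsTree ∧ r ∈ S.verts ∧ T ⊆ S.verts

/-- The optimal cost of Steiner tree with root `r`, as a function of the set of terminals. -/
def steinerCost {X : Type*} [MetricSpace X] (r : X) (T : Set X) : ℝ :=
  sInf (treeLength '' {S | IsSteinerTree r T S})

/-- On a finite metric space feasible trees exist and the infimum is a minimum. -/
theorem steinerCost_isLeast {X : Type*} [Finite X] [MetricSpace X] (r : X) (T : Set X) :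
    IsLeast (treeLength '' {S | IsSteinerTree r T S}) (steinerCost r T) := by
  have hfin : (treeLength '' {S | IsSteinerTree r T S}).Finite := (Set.toFinite _).image _
  refine hfin.isCompact.isLeast_sInf ?_
  have : Nonempty X := ⟨r⟩
  obtain ⟨G, -, hG⟩ := (SimpleGraph.connected_top (V := X)).exists_isTree_le
  refine Set.Nonempty.image _ ⟨SimpleGraph.toSubgraph G le_top, ?_, by simp, by simp⟩
  have e : (SimpleGraph.toSubgraph G (le_top : G ≤ ⊤)).coe ≃g G :=
    ⟨Equiv.Set.univ X, by intro a b; rfl⟩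
  exact e.isTree_iff.mpr hG

/-- Submodular set functions. -/
def IsSubmodular {X : Type*} (g : Set X → ℝ) : Prop :=
  ∀ A B : Set X, g (A ∪ B) + g (A ∩ B) ≤ g A + g B

/-- `f` is `lam`-approximated by a submodular function. -/
def IsSubmodularApprox {X : Type*} (f : Set X → ℝ) (lam : ℝ) : Prop :=
  ∃ g : Set X → ℝ, IsSubmodular g ∧ ∀ S : Set X, f S ≤ g S ∧ g S ≤ lam * f S

/-- The submodularity gap of a set function: the least (infimal) `lam` such that the function is
`lam`-approximated by a submodular function (`⊤` if there is none). -/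
def submodularityGap {X : Type*} (f : Set X → ℝ) : ℝ≥0∞ :=
  ⨅ (lam : ℝ≥0) (_ : IsSubmodularApprox f lam), (lam : ℝ≥0∞)

/-- The submodularity gap of the Steiner tree problem on metric spaces with `n` points:
the supremum of the gaps of the optimal cost functions over all such spaces and all roots. -/
def steinerTreeGap (n : ℕ) : ℝ≥0∞ :=
  ⨆ (X : Type) (_ : Fintype X) (_ : MetricSpace X) (_ : Fintype.card X = n) (r : X),
    submodularityGap (fun T : Set X => steinerCost r T)

end

/-! Upper bound. Fix an order of the points and a radius `R`, and send each point to the first point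
of its `R`-ball, with the centre used by the root `r` replaced by `r`. The number of centres other
than `r` hit by `T` is a coverage function of `T`, hence submodular. Let `g` be the average over all
orders of the sum of these counts over the radii `k * ε`, with weight `12 * ε`. For every order,
moving `T` to the root through centres at dyadically growing radii shows that the cost is at most
the sum (`steinerCost_le_sum_clusters`). Conversely, a random order separates `x` and `y` at no more
than `H_n * (dist x y / ε + 1)` radii on average (`sum_separated_le`), so `g` is at most `48 * H_n`
times the length of an optimal tree (`sum_clusters_le_steinerCost`).

Lower bound. In a diamond of depth `k`, a single path costs at most `2 ^ k`. Two bundles of `2 ^ i`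
paths that differ only in finer levels share all vertices of the depth-`i` diamond, which cost at
least `2 ^ (k + i) / 4`. Submodularity, applied while bundles are merged in pairs, loses this amount
at each merger. After `k` rounds, nonnegativity forces `k / 8 ≤ lam`
(`IsDiamond.depth_le_of_approx`). The diamond has about `4 ^ k` points, so `k` is of order `log n`.
-/

/-! ### Basic bounds on Steiner cost -/

/-- The variation of a function along an edge. -/
noncomputable def edgeVariation {X : Type*} (h : X → ℝ) (e : Sym2 X) : ℝ :=
  Sym2.lift ⟨fun x y => |h x - h y|, fun x y => abs_sub_comm (h x) (h y)⟩ e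

@[simp] theorem edgeVariation_mk {X : Type*} (h : X → ℝ) (x y : X) :
    edgeVariation h s(x, y) = |h x - h y| := rfl

@[simp] theorem edgeLength_mk {X : Type*} [MetricSpace X] (x y : X) :
    edgeLength s(x, y) = dist x y := rfl

theorem edgeVariation_nonneg {X : Type*} (h : X → ℝ) (e : Sym2 X) : 0 ≤ edgeVariation h e := by
  induction e with | _ x y => exact abs_nonneg _

theorem edgeLength_nonneg {X : Type*} [MetricSpace X] (e : Sym2 X) : 0 ≤ edgeLength e := by
  induction e with | _ x y => exact dist_nonneg

theorem abs_sub_le_sum_edges {X : Type*} {G : SimpleGraph X} (h : X → ℝ) {x y : X}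
    (p : G.Walk x y) : |h x - h y| ≤ (p.edges.map (edgeVariation h)).sum := by
  induction p with
  | nil => simp
  | @cons u v w huv p ih =>
    simp only [SimpleGraph.Walk.edges_cons, List.map_cons, List.sum_cons, edgeVariation_mk]
    exact (abs_sub_le (h u) (h v) (h w)).trans (by gcongr)

open Classical in
theorem treeLength_eq_sum {X : Type*} [Fintype X] [MetricSpace X]
    (S : (⊤ : SimpleGraph X).Subgraph) :
    treeLength S = ∑ e ∈ S.edgeSet.toFinset, edgeLength e :=
  finsum_mem_eq_toFinset_sum _ _

-- A path uses each edge at most once, so its variation is bounded by that of the whole tree.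
open Classical in
theorem abs_sub_le_sum_edgeVariation {X : Type*} [Fintype X]
    {S : (⊤ : SimpleGraph X).Subgraph} (hS : S.coe.Connected) (h : X → ℝ) {x y : X}
    (hx : x ∈ S.verts) (hy : y ∈ S.verts) :
    |h x - h y| ≤ ∑ e ∈ S.edgeSet.toFinset, edgeVariation h e := by
  let f : S.coe →g S.spanningCoe := ⟨Subtype.val, fun h => h⟩
  have hr : S.spanningCoe.Reachable x y := (hS.preconnected ⟨x, hx⟩ ⟨y, hy⟩).map f
  obtain ⟨p, hp⟩ := hr.exists_isPath
  refine (abs_sub_le_sum_edges h p).trans ?_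
  rw [← List.sum_toFinset _ hp.isTrail.edges_nodup]
  refine Finset.sum_le_sum_of_subset_of_nonneg ?_ fun e _ _ => edgeVariation_nonneg h e
  intro e he
  simpa using p.edges_subset_edgeSet (by simpa using he)

/-- A family of functions of bounded total variation along every edge gives a lower bound on the
length of Steiner trees. -/
theorem sum_le_mul_steinerCost {X ι : Type*} [Fintype X] [MetricSpace X] (r : X) (T : Set X)
    (I : Finset ι) (h : ι → X → ℝ) (a : ι → ℝ) {K : ℝ}
    (hK : ∀ x y : X, x ≠ y → ∑ i ∈ I, |h i x - h i y| ≤ K * dist x y)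
    (ha : ∀ i ∈ I, ∃ x ∈ insert r T, ∃ y ∈ insert r T, a i ≤ |h i x - h i y|) :
    ∑ i ∈ I, a i ≤ K * steinerCost r T := by
  classical
  obtain ⟨S, ⟨hS, hr, hT⟩, hlen⟩ := (steinerCost_isLeast r T).1
  rw [← hlen, treeLength_eq_sum, Finset.mul_sum]
  calc ∑ i ∈ I, a i ≤ ∑ i ∈ I, ∑ e ∈ S.edgeSet.toFinset, edgeVariation (h i) e := by
        refine Finset.sum_le_sum fun i hi => ?_
        obtain ⟨x, hx, y, hy, hxy⟩ := ha i hi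
        have hs : insert r T ⊆ S.verts := Set.insert_subset hr hT
        exact hxy.trans (abs_sub_le_sum_edgeVariation hS.1 _ (hs hx) (hs hy))
    _ = ∑ e ∈ S.edgeSet.toFinset, ∑ i ∈ I, edgeVariation (h i) e := Finset.sum_comm
    _ ≤ _ := by
        refine Finset.sum_le_sum fun e he => ?_
        induction e with | _ x y =>
        have hadj : S.Adj x y := by simpa using he
        exact hK x y hadj.adj_sub.ne

theorem steinerCost_mono {X : Type*} [Finite X] [MetricSpace X] (r : X) {T U : Set X}
    (h : T ⊆ U) : steinerCost r T ≤ steinerCost r U := by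
  obtain ⟨S, ⟨hS, hr, hT⟩, hlen⟩ := (steinerCost_isLeast r U).1
  rw [← hlen]
  exact (steinerCost_isLeast r T).2 ⟨S, ⟨hS, hr, h.trans hT⟩, rfl⟩

theorem steinerCost_nonneg {X : Type*} [Finite X] [MetricSpace X] (r : X) (T : Set X) :
    0 ≤ steinerCost r T := by
  obtain ⟨S, -, hlen⟩ := (steinerCost_isLeast r T).1
  rw [← hlen]
  exact finsum_nonneg fun e => finsum_nonneg fun _ => edgeLength_nonneg e

/-- Every connected subgraph contains a tree on the same vertices. -/
theorem exists_isTree_of_connected {X : Type*} [Finite X] (H : (⊤ : SimpleGraph X).Subgraph)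
    (hH : H.Connected) :
    ∃ S : (⊤ : SimpleGraph X).Subgraph, S.coe.IsTree ∧ S.verts = H.verts ∧
      S.edgeSet ⊆ H.edgeSet := by
  obtain ⟨G, hle, hG⟩ := (SimpleGraph.Subgraph.connected_iff'.mp hH).exists_isTree_le
  let S : (⊤ : SimpleGraph X).Subgraph :=
    { verts := H.verts
      Adj := fun x y => ∃ (hx : x ∈ H.verts) (hy : y ∈ H.verts), G.Adj ⟨x, hx⟩ ⟨y, hy⟩
      adj_sub := fun ⟨_, _, h⟩ => (hle h : H.Adj _ _).adj_sub
      edge_vert := fun ⟨hx, _, _⟩ => hx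
      symm := ⟨fun _ _ ⟨hx, hy, h⟩ => ⟨hy, hx, h.symm⟩⟩ }
  refine ⟨S, ?_, rfl, ?_⟩
  · have : S.coe = G := by
      ext ⟨x, hx⟩ ⟨y, hy⟩
      exact ⟨fun ⟨_, _, h⟩ => h, fun h => ⟨hx, hy, h⟩⟩
    exact this ▸ hG
  · intro e
    induction e with | _ x y =>
    rintro ⟨hx, hy, h⟩
    exact hle h

/-- A spanning tree is no longer than the connected graph, so later constructions need not check
acyclicity. -/
theorem steinerCost_le_treeLength {X : Type*} [Finite X] [MetricSpace X] {r : X} {T : Set X}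
    (H : (⊤ : SimpleGraph X).Subgraph) (hH : H.Connected) (hr : r ∈ H.verts)
    (hT : T ⊆ H.verts) : steinerCost r T ≤ treeLength H := by
  classical
  cases nonempty_fintype X
  obtain ⟨S, hS, hv, he⟩ := exists_isTree_of_connected H hH
  refine ((steinerCost_isLeast r T).2 ⟨S, ⟨hS, hv ▸ hr, hv ▸ hT⟩, rfl⟩).trans ?_
  rw [treeLength_eq_sum, treeLength_eq_sum]
  exact Finset.sum_le_sum_of_subset_of_nonneg (by simpa using he)
    fun e _ _ => edgeLength_nonneg e

theorem steinerCost_subset_root {X : Type*} [Finite X] [MetricSpace X] (r : X) {T : Set X}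
    (hT : T ⊆ {r}) : steinerCost r T = 0 := by
  refine le_antisymm ?_ (steinerCost_nonneg r T)
  refine (steinerCost_le_treeLength ((⊤ : SimpleGraph X).singletonSubgraph r)
    (SimpleGraph.Subgraph.singletonSubgraph_connected) (by simp) (by simpa using hT)).trans ?_
  simp [treeLength]

theorem steinerCost_insert_le {X : Type*} [Finite X] [MetricSpace X] (r : X) {T : Set X} (x : X)
    {y : X} (hy : y ∈ insert r T) :
    steinerCost r (insert x T) ≤ steinerCost r T + dist x y := by
  classical
  cases nonempty_fintype X
  obtain ⟨S, ⟨hS, hr, hT⟩, hlen⟩ := (steinerCost_isLeast r T).1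
  have hyS : y ∈ S.verts := Set.insert_subset hr hT hy
  rw [← hlen]
  by_cases hxy : x = y
  · subst hxy
    rw [dist_self, add_zero]
    exact (steinerCost_isLeast r _).2 ⟨S, ⟨hS, hr, Set.insert_subset hyS hT⟩, rfl⟩
  · have hadj : (⊤ : SimpleGraph X).Adj x y := hxy
    have hconn : (S ⊔ (⊤ : SimpleGraph X).subgraphOfAdj hadj).Connected :=
      SimpleGraph.Subgraph.connected_sup (SimpleGraph.Subgraph.connected_iff'.mpr hS.1).preconnected
        (SimpleGraph.Subgraph.subgraphOfAdj_connected hadj).preconnected ⟨y, by simp [hyS]⟩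
    refine (steinerCost_le_treeLength _ hconn (by simp [hr]) ?_).trans ?_
    · refine Set.insert_subset (by simp) (hT.trans fun z hz => by simp [hz])
    · rw [treeLength_eq_sum, treeLength_eq_sum, Finset.sum_congr
        (show (S ⊔ (⊤ : SimpleGraph X).subgraphOfAdj hadj).edgeSet.toFinset =
          S.edgeSet.toFinset ∪ {s(x, y)} by ext e; simp) fun _ _ => rfl]
      refine (le_add_of_nonneg_right (Finset.sum_nonneg fun e _ => edgeLength_nonneg e)).trans_eq
        ((Finset.sum_union_inter).trans ?_)
      rw [Finset.sum_singleton, edgeLength_mk]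

theorem steinerCost_union_le {X : Type*} [Finite X] [MetricSpace X] (r : X) (T : Set X)
    (A : Finset X) {D : ℝ} (hA : ∀ x ∈ A, ∃ y ∈ insert r T, dist x y ≤ D) :
    steinerCost r (T ∪ A) ≤ steinerCost r T + A.card * D := by
  classical
  induction A using Finset.induction_on with
  | empty => simp
  | insert x A hx ih =>
    obtain ⟨y, hy, hxy⟩ := hA x (by simp)
    have := ih fun z hz => hA z (by simp [hz])
    have h2 := steinerCost_insert_le r (T := T ∪ A) x (y := y)
      (Set.insert_subset_insert Set.subset_union_left hy)
    rw [Finset.coe_insert, Set.union_insert, Finset.card_insert_of_notMem hx]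
    push_cast
    linarith

/-- Connecting the images of `T` under a chain of maps ending in the root. -/
theorem steinerCost_image_le_sum {X : Type*} [Fintype X] [DecidableEq X] [MetricSpace X] (r : X)
    (T : Finset X) (ψ : ℕ → X → X) (D : ℕ → ℝ) (J : ℕ) (hJ : ∀ x, ψ J x = r)
    (hD : ∀ j < J, ∀ x, dist (ψ j x) (ψ (j + 1) x) ≤ D j) :
    steinerCost r (T.image (ψ 0) : Set X) ≤
      ∑ j ∈ Finset.range J, D j * ((T.image (ψ j)).erase r).card := by
  -- Induction starts at the root end of the chain: for `i = 0` all images equal `r`, and each step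
  -- attaches the points of the next finer level to their images.
  have key : ∀ i ≤ J, steinerCost r (T.image (ψ (J - i)) : Set X) ≤
      ∑ j ∈ Finset.Ico (J - i) J, D j * ((T.image (ψ j)).erase r).card := by
    intro i
    induction i with
    | zero =>
      intro _
      rw [steinerCost_subset_root]
      · simp
      · intro x
        simp only [Nat.sub_zero, hJ, Finset.coe_image, Set.mem_image]
        rintro ⟨_, -, rfl⟩
        rfl
    | succ i ih =>
      intro hi
      obtain ⟨m, hm⟩ : ∃ m, m = J - (i + 1) := ⟨_, rfl⟩
      have hm1 : J - i = m + 1 := by omega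
      have ih := ih (by omega)
      rw [hm1] at ih
      rw [← hm, Finset.sum_eq_sum_Ico_succ_bot (by omega)]
      have h1 := steinerCost_union_le r (T.image (ψ (m + 1)) : Set X)
        ((T.image (ψ m)).erase r) (D := D m) (by
          intro x hx
          obtain ⟨t, ht, rfl⟩ := Finset.mem_image.mp (Finset.mem_of_mem_erase hx)
          exact ⟨ψ (m + 1) t, Or.inr (by simpa using ⟨t, ht, rfl⟩), hD m (by omega) t⟩)
      have h2 : steinerCost r (T.image (ψ m) : Set X) ≤
          steinerCost r (insert r ((T.image (ψ (m + 1)) : Set X) ∪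
            ((T.image (ψ m)).erase r : Finset X))) := by
        refine steinerCost_mono r fun x hx => ?_
        by_cases hxr : x = r
        · exact Or.inl hxr
        · exact Or.inr (Or.inr (by simpa [hxr] using hx))
      have h3 := steinerCost_insert_le r (T := (T.image (ψ (m + 1)) : Set X) ∪
            ((T.image (ψ m)).erase r : Finset X)) r (Set.mem_insert r _)
      rw [dist_self] at h3
      linarith [mul_comm (D m) (((T.image (ψ m)).erase r).card : ℝ)]
  simpa using key J le_rfl

/-! ### Separation probabilities for random orders -/

/-- In a uniformly random order every member of `A` is equally likely to be the first one. -/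
theorem card_mul_card_first_le {X : Type*} [Fintype X] [DecidableEq X] {n : ℕ} (A : Finset X)
    {w : X} (hw : w ∈ A) :
    A.card * (Finset.univ.filter fun π : X ≃ Fin n => ∀ a ∈ A, π w ≤ π a).card ≤
      Fintype.card (X ≃ Fin n) := by
  let E : X → Finset (X ≃ Fin n) := fun v => Finset.univ.filter fun π => ∀ a ∈ A, π v ≤ π a
  -- Swapping `v` and `w` preserves `A`, so orders with `w` first inject into orders with `v` first.
  have hE : ∀ v ∈ A, (E w).card ≤ (E v).card := by
    intro v hv
    refine Finset.card_le_card_of_injOn (fun π => (Equiv.swap v w).trans π) ?_ ?_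
    · intro π hπ
      simp only [E, Finset.coe_filter, Finset.mem_univ, true_and, Set.mem_ofPred_eq,
        Equiv.trans_apply, Equiv.swap_apply_left] at hπ ⊢
      intro a ha
      refine hπ _ ?_
      rw [Equiv.swap_apply_def]
      split_ifs <;> assumption
    · intro π _ π' _ h
      ext x
      simpa using congrArg Fin.val (DFunLike.congr_fun h (Equiv.swap v w x))
  have hdisj : (A : Set X).PairwiseDisjoint E := by
    intro v hv v' hv' hne
    refine Finset.disjoint_left.mpr fun π h h' => hne ?_
    simp only [E, Finset.mem_filter, Finset.mem_univ, true_and] at h h'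
    exact π.injective (le_antisymm (h v' hv') (h' v hv))
  calc A.card * (E w).card = ∑ v ∈ A, (E w).card := by simp
    _ ≤ ∑ v ∈ A, (E v).card := Finset.sum_le_sum hE
    _ = (A.biUnion E).card := (Finset.card_biUnion hdisj).symm
    _ ≤ _ := Finset.card_le_univ _

/-- Inserting a point of maximal value contributes exactly the reciprocal of the new cardinality;
the other ranks can only grow, so ties do no harm. -/
theorem sum_inv_rank_le_harmonic {X : Type*} [DecidableEq X] (m : X → ℝ) (s : Finset X) :
    ∑ w ∈ s, (((s.filter fun v => m v ≤ m w).card : ℝ))⁻¹ ≤ (harmonic s.card : ℝ) := by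
  induction s using Finset.induction_on_max_value m with
  | empty => simp
  | insert a s ha hmax ih =>
    rw [Finset.sum_insert ha, Finset.card_insert_of_notMem ha, harmonic_succ]
    push_cast
    rw [add_comm]
    refine add_le_add ((Finset.sum_le_sum fun w hw => ?_).trans ih) (le_of_eq ?_)
    · have hpos : 0 < (s.filter fun v => m v ≤ m w).card :=
        Finset.card_pos.mpr ⟨w, by simp [hw]⟩
      gcongr
      exact Finset.subset_insert _ _
    · rw [Finset.filter_true_of_mem, Finset.card_insert_of_notMem ha]
      · push_cast; rfl
      · intro v hv
        rcases Finset.mem_insert.mp hv with rfl | hv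
        · exact le_rfl
        · exact hmax v hv

theorem card_multiples_between_le {ε m M d : ℝ} (hε : 0 < ε) (hd : 0 ≤ d)
    (hM : M - m ≤ d) (s : Finset ℕ) :
    ((s.filter fun k : ℕ => m ≤ k * ε ∧ k * ε < M).card : ℝ) ≤ d / ε + 1 := by
  have hsub : (s.filter fun k : ℕ => m ≤ k * ε ∧ k * ε < M) ⊆
      Finset.Ico ⌈m / ε⌉₊ ⌈M / ε⌉₊ := by
    intro k hk
    obtain ⟨-, h1, h2⟩ := Finset.mem_filter.mp hk
    rw [Finset.mem_Ico, Nat.ceil_le, Nat.lt_ceil, div_le_iff₀ hε, lt_div_iff₀ hε]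
    exact ⟨h1, h2⟩
  have hcard := Finset.card_le_card hsub
  rw [Nat.card_Ico] at hcard
  rcases le_total ⌈M / ε⌉₊ ⌈m / ε⌉₊ with h | h
  · rw [Nat.sub_eq_zero_of_le h] at hcard
    rw [Nat.le_zero.mp hcard]
    push_cast
    positivity
  · have h1 : ((⌈M / ε⌉₊ - ⌈m / ε⌉₊ : ℕ) : ℝ) ≤ d / ε + 1 := by
      rw [Nat.cast_sub h]
      -- The natural-number ceiling truncates negative values to `0`, so this case is separate.
      rcases le_or_gt M 0 with h0 | h0
      · rw [Nat.ceil_eq_zero.mpr (div_nonpos_of_nonpos_of_nonneg h0 hε.le)]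
        have : 0 ≤ d / ε := by positivity
        have : (0 : ℝ) ≤ ⌈m / ε⌉₊ := by positivity
        push_cast
        linarith
      · have h2 := Nat.ceil_lt_add_one (show 0 ≤ M / ε by positivity)
        have h3 := Nat.le_ceil (m / ε)
        have h4 : M / ε - m / ε ≤ d / ε := by rw [← sub_div]; gcongr
        linarith
    exact (Nat.cast_le.mpr hcard).trans h1

/-- The points at distance at most `R` from `x`, and `x` itself. -/
noncomputable def pointBall {X : Type*} [Fintype X] [MetricSpace X] (R : ℝ) (x : X) : Finset X :=
  open Classical in Finset.univ.filter fun w => w = x ∨ dist x w ≤ R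

theorem exists_first_in_ball {X : Type*} [Fintype X] [MetricSpace X] {n : ℕ} (π : X ≃ Fin n)
    (R : ℝ) (x : X) : ∃ w ∈ pointBall R x, ∀ v ∈ pointBall R x, π w ≤ π v :=
  Finset.exists_min_image _ π ⟨x, by simp [pointBall]⟩

/-- The first point of the ball of radius `R` around `x` in the order `π`. -/
noncomputable def ballCenter {X : Type*} [Fintype X] [MetricSpace X] {n : ℕ} (π : X ≃ Fin n)
    (R : ℝ) (x : X) : X :=
  (exists_first_in_ball π R x).choose

theorem ballCenter_mem {X : Type*} [Fintype X] [MetricSpace X] {n : ℕ} (π : X ≃ Fin n)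
    (R : ℝ) (x : X) : ballCenter π R x ∈ pointBall R x :=
  (exists_first_in_ball π R x).choose_spec.1

theorem ballCenter_le {X : Type*} [Fintype X] [MetricSpace X] {n : ℕ} (π : X ≃ Fin n)
    (R : ℝ) (x : X) {v : X} (hv : v ∈ pointBall R x) : π (ballCenter π R x) ≤ π v :=
  (exists_first_in_ball π R x).choose_spec.2 v hv

theorem mem_pointBall {X : Type*} [Fintype X] [MetricSpace X] {R : ℝ} (hR : 0 ≤ R) {x w : X} :
    w ∈ pointBall R x ↔ dist x w ≤ R := by
  simp only [pointBall, Finset.mem_filter, Finset.mem_univ, true_and, or_iff_right_iff_imp]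
  rintro rfl
  simpa using hR

theorem ballCenter_eq_of_first {X : Type*} [Fintype X] [MetricSpace X] {n : ℕ} (π : X ≃ Fin n)
    {R : ℝ} {x w : X} (hw : w ∈ pointBall R x) (h : ∀ v ∈ pointBall R x, π w ≤ π v) :
    ballCenter π R x = w :=
  π.injective (le_antisymm (ballCenter_le π R x hw) (h _ (ballCenter_mem π R x)))

/-- If the balls around `x` and `y` have different first points, then the first point of their
union lies in only one of them. -/
theorem exists_first_of_ballCenter_ne {X : Type*} [Fintype X] [DecidableEq X] [MetricSpace X]
    {n : ℕ} (π : X ≃ Fin n) {R : ℝ} (hR : 0 ≤ R) {x y : X}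
    (h : ballCenter π R x ≠ ballCenter π R y) :
    ∃ w, min (dist x w) (dist y w) ≤ R ∧ R < max (dist x w) (dist y w) ∧
      ∀ v ∈ pointBall R x ∪ pointBall R y, π w ≤ π v := by
  obtain ⟨w, hw, hmin⟩ := Finset.exists_min_image (pointBall R x ∪ pointBall R y) π
    ⟨_, Finset.mem_union_left _ (ballCenter_mem π R x)⟩
  refine ⟨w, ?_, ?_, hmin⟩
  · rw [min_le_iff, ← mem_pointBall hR, ← mem_pointBall hR]
    exact Finset.mem_union.mp hw
  · by_contra! hcon
    rw [max_le_iff, ← mem_pointBall hR, ← mem_pointBall hR] at hcon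
    apply h
    rw [ballCenter_eq_of_first π hcon.1 fun v hv => hmin v (Finset.mem_union_left _ hv),
      ballCenter_eq_of_first π hcon.2 fun v hv => hmin v (Finset.mem_union_right _ hv)]

open Classical in
/-- For a random order, the expected number of radii `k * ε` that separate `x` and `y` is at most
a harmonic number times the distance of `x` and `y` in units of `ε`. -/
theorem sum_separated_le {X : Type*} [Fintype X] [MetricSpace X] {n : ℕ} {ε : ℝ}
    (hε : 0 < ε) (s : Finset ℕ) (x y : X) :
    ∑ π : X ≃ Fin n, ∑ k ∈ s,
      (if ballCenter π (k * ε) x ≠ ballCenter π (k * ε) y then (1 : ℝ) else 0) ≤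
      Fintype.card (X ≃ Fin n) * harmonic (Fintype.card X) * (dist x y / ε + 1) := by
  let m : X → ℝ := fun w => min (dist x w) (dist y w)
  let M : X → ℝ := fun w => max (dist x w) (dist y w)
  let A : ℕ → Finset X := fun k => pointBall (k * ε) x ∪ pointBall (k * ε) y
  let P : ℕ → X → Prop := fun k w => m w ≤ k * ε ∧ k * ε < M w
  let F : ℝ := Fintype.card (X ≃ Fin n)
  let ρ : X → ℝ := fun w => (Finset.univ.filter fun v => m v ≤ m w).card
  have hρ : ∀ w, 0 < ρ w := fun w => by
    have : 0 < (Finset.univ.filter fun v => m v ≤ m w).card := Finset.card_pos.mpr ⟨w, by simp⟩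
    exact Nat.cast_pos.mpr this
  have hR : ∀ k : ℕ, 0 ≤ k * ε := fun k => by positivity
  have hone : ∀ (π : X ≃ Fin n) (k : ℕ),
      (if ballCenter π (k * ε) x ≠ ballCenter π (k * ε) y then (1 : ℝ) else 0) ≤
        ∑ w, if P k w ∧ ∀ v ∈ A k, π w ≤ π v then (1 : ℝ) else 0 := by
    intro π k
    split_ifs with h
    · obtain ⟨w, h1, h2, h3⟩ := exists_first_of_ballCenter_ne π (hR k) h
      have hw : P k w ∧ ∀ v ∈ A k, π w ≤ π v := ⟨⟨h1, h2⟩, h3⟩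
      refine le_trans (by rw [if_pos hw]) (Finset.single_le_sum (f := fun w =>
        if P k w ∧ ∀ v ∈ A k, π w ≤ π v then (1 : ℝ) else 0) (fun v _ => ?_) (Finset.mem_univ w))
      positivity
    · exact Finset.sum_nonneg fun w _ => by positivity
  have hfirst : ∀ (k : ℕ) (w : X),
      (∑ π : X ≃ Fin n, if P k w ∧ ∀ v ∈ A k, π w ≤ π v then (1 : ℝ) else 0) ≤
        if P k w then F * (ρ w)⁻¹ else 0 := by
    intro k w
    by_cases hP : P k w
    · simp only [hP, true_and, if_true]
      rw [Finset.sum_boole, ← div_eq_mul_inv, le_div_iff₀ (hρ w), mul_comm]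
      have hwA : w ∈ A k := by
        have := hP.1
        rw [min_le_iff, ← mem_pointBall (hR k), ← mem_pointBall (hR k)] at this
        exact Finset.mem_union.mpr this
      -- All points as close to `{x, y}` as `w` lie in `A k`. Hence `w` comes first with probability
      -- at most `(ρ w)⁻¹`, a bound that does not depend on `k`.
      have h1 : ρ w ≤ (A k).card := by
        refine Nat.cast_le.mpr (Finset.card_le_card fun v hv => ?_)
        have : m v ≤ k * ε := (Finset.mem_filter.mp hv).2.trans hP.1
        rw [min_le_iff, ← mem_pointBall (hR k), ← mem_pointBall (hR k)] at this
        exact Finset.mem_union.mpr this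
      refine (mul_le_mul_of_nonneg_right h1 (Nat.cast_nonneg _)).trans ?_
      rw [← Nat.cast_mul]
      exact Nat.cast_le.mpr (card_mul_card_first_le (n := n) (A k) hwA)
    · simp [hP]
  calc _ ≤ ∑ π : X ≃ Fin n, ∑ k ∈ s, ∑ w,
          (if P k w ∧ ∀ v ∈ A k, π w ≤ π v then (1 : ℝ) else 0) :=
        Finset.sum_le_sum fun π _ => Finset.sum_le_sum fun k _ => hone π k
    _ = ∑ k ∈ s, ∑ w, ∑ π : X ≃ Fin n,
          (if P k w ∧ ∀ v ∈ A k, π w ≤ π v then (1 : ℝ) else 0) := by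
        rw [Finset.sum_comm]
        exact Finset.sum_congr rfl fun k _ => Finset.sum_comm
    _ ≤ ∑ k ∈ s, ∑ w, if P k w then F * (ρ w)⁻¹ else 0 :=
        Finset.sum_le_sum fun k _ => Finset.sum_le_sum fun w _ => hfirst k w
    _ = ∑ w, F * (ρ w)⁻¹ * ((s.filter fun k => P k w).card : ℝ) := by
        rw [Finset.sum_comm]
        refine Finset.sum_congr rfl fun w _ => ?_
        rw [← Finset.sum_filter, Finset.sum_const, nsmul_eq_mul, mul_comm]
    _ ≤ ∑ w, F * (ρ w)⁻¹ * (dist x y / ε + 1) := by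
        refine Finset.sum_le_sum fun w _ => ?_
        have := hρ w
        refine mul_le_mul_of_nonneg_left ?_ (by positivity)
        refine card_multiples_between_le hε dist_nonneg ?_ s
        rw [max_sub_min_eq_abs, abs_sub_comm]
        exact abs_dist_sub_le x y w
    _ = F * (∑ w, (ρ w)⁻¹) * (dist x y / ε + 1) := by
        rw [Finset.mul_sum, Finset.sum_mul]
    _ ≤ F * harmonic (Fintype.card X) * (dist x y / ε + 1) := by
        gcongr
        exact sum_inv_rank_le_harmonic m Finset.univ

/-! ### The submodular approximation and the upper bound -/

/-- The centre of the cluster of `x`, with the centre of the cluster of the root moved to the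
root. -/
noncomputable def rootedCenter {X : Type*} [Fintype X] [MetricSpace X] {n : ℕ} (r : X)
    (π : X ≃ Fin n) (R : ℝ) (x : X) : X :=
  open Classical in if ballCenter π R x = ballCenter π R r then r else ballCenter π R x

theorem rootedCenter_root {X : Type*} [Fintype X] [MetricSpace X] {n : ℕ} (r : X)
    (π : X ≃ Fin n) (R : ℝ) : rootedCenter r π R r = r := by
  simp [rootedCenter]

theorem ballCenter_ne_of_rootedCenter_ne {X : Type*} [Fintype X] [MetricSpace X] {n : ℕ} {r : X}
    {π : X ≃ Fin n} {R : ℝ} {x y : X} (h : rootedCenter r π R x ≠ rootedCenter r π R y) :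
    ballCenter π R x ≠ ballCenter π R y := by
  intro h'
  unfold rootedCenter at h
  rw [h'] at h
  exact h rfl

theorem dist_rootedCenter_le {X : Type*} [Fintype X] [MetricSpace X] {n : ℕ} (r : X)
    (π : X ≃ Fin n) {R : ℝ} (hR : 0 ≤ R) (x : X) : dist x (rootedCenter r π R x) ≤ 2 * R := by
  have hx := (mem_pointBall hR).mp (ballCenter_mem π R x)
  have hr := (mem_pointBall hR).mp (ballCenter_mem π R r)
  unfold rootedCenter
  split_ifs with h
  · rw [h] at hx
    linarith [dist_triangle_right x r (ballCenter π R r)]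
  · linarith

theorem rootedCenter_of_small {X : Type*} [Fintype X] [MetricSpace X] {n : ℕ} (r : X)
    (π : X ≃ Fin n) {R : ℝ} (hR : 0 ≤ R) (h : ∀ x y : X, x ≠ y → R < dist x y) (x : X) :
    rootedCenter r π R x = x := by
  have hc : ∀ z, ballCenter π R z = z := fun z => by
    by_contra hne
    exact absurd ((mem_pointBall hR).mp (ballCenter_mem π R z)) (not_le.mpr (h _ _ (Ne.symm hne)))
  unfold rootedCenter
  rw [hc, hc]
  split_ifs with h <;> simp [h]

/-- This is the submodularity of coverage: the image of an intersection lies in the intersection of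
the images. -/
theorem card_image_erase_submodular {X : Type*} [DecidableEq X] (f : X → X) (r : X)
    (A B : Finset X) :
    (((A ∪ B).image f).erase r).card + (((A ∩ B).image f).erase r).card ≤
      ((A.image f).erase r).card + ((B.image f).erase r).card := by
  rw [Finset.image_union, Finset.erase_union_distrib,
    ← Finset.card_union_add_card_inter ((A.image f).erase r)]
  refine Nat.add_le_add_left (Finset.card_le_card fun x hx => ?_) _
  simp only [Finset.mem_erase, Finset.mem_image, Finset.mem_inter] at hx ⊢
  obtain ⟨hr, t, ⟨hA, hB⟩, rfl⟩ := hx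
  exact ⟨⟨hr, t, hA, rfl⟩, hr, t, hB, rfl⟩

theorem sum_dyadic_blocks (f : ℕ → ℝ) (J : ℕ) :
    ∑ j ∈ Finset.range J, ∑ k ∈ Finset.Ico (2 ^ j) (2 ^ (j + 1)), f k =
      ∑ k ∈ Finset.Ico 1 (2 ^ J), f k := by
  induction J with
  | zero => simp
  | succ J ih =>
    rw [Finset.sum_range_succ, ih, Finset.sum_Ico_consecutive _ Nat.one_le_two_pow
      (Nat.pow_le_pow_right two_pos J.le_succ)]

-- In each block `2 ^ j ≤ k < 2 ^ (j + 1)` take the radius with the fewest centres. One chain step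
-- there costs order `2 ^ j * ε` per centre, and the block has `2 ^ j` radii, each with at least as
-- many centres.
open Classical in
theorem steinerCost_le_sum_clusters {X : Type*} [Fintype X] [MetricSpace X] {n : ℕ} (r : X)
    (π : X ≃ Fin n) {ε : ℝ} (hε : 0 < ε) (hmin : ∀ x y : X, x ≠ y → ε < dist x y) {J : ℕ}
    (hJ0 : J ≠ 0) (hJ : ∀ x y : X, dist x y ≤ 2 ^ J * ε) (T : Finset X) :
    steinerCost r (T : Set X) ≤ ∑ k ∈ Finset.Ico (1 : ℕ) (2 ^ J),
      12 * ε * ((T.image (rootedCenter r π (k * ε))).erase r).card := by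
  let N : ℕ → ℕ := fun k => ((T.image (rootedCenter r π (k * ε))).erase r).card
  have hex : ∀ j : ℕ, ∃ k ∈ Finset.Ico (2 ^ j) (2 ^ (j + 1)),
      ∀ l ∈ Finset.Ico (2 ^ j) (2 ^ (j + 1)), N k ≤ N l := fun j =>
    Finset.exists_min_image _ N ⟨2 ^ j, by simp [pow_succ]⟩
  choose κ hκ hκmin using hex
  let ψ : ℕ → X → X := fun j x => if j < J then rootedCenter r π (κ j * ε) x else r
  have hκlt : ∀ j, (κ j : ℝ) ≤ 2 * 2 ^ j := fun j => by
    have := (Finset.mem_Ico.mp (hκ j)).2.le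
    rw [pow_succ, mul_comm] at this
    exact_mod_cast this
  have hψ : ∀ j ≤ J, ∀ x, dist x (ψ j x) ≤ 4 * 2 ^ j * ε := by
    intro j hj x
    rcases hj.lt_or_eq with hlt | rfl
    · simp only [ψ, if_pos hlt]
      refine (dist_rootedCenter_le r π (by positivity) x).trans ?_
      nlinarith [hκlt j]
    · simp only [ψ, lt_irrefl, if_false]
      refine (hJ x r).trans ?_
      gcongr
      linarith [show (0 : ℝ) < 2 ^ j by positivity]
  have hψ0 : ∀ x, ψ 0 x = x := by
    intro x
    -- The block of `j = 0` is `{1}`, and balls of radius `ε` are singletons, so the chain starts at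
    -- `T` itself.
    have h1 : κ 0 = 1 := by
      have := Finset.mem_Ico.mp (hκ 0)
      simp at this
      omega
    simp only [ψ, if_pos (Nat.pos_of_ne_zero hJ0), h1, Nat.cast_one, one_mul]
    exact rootedCenter_of_small r π hε.le hmin x
  -- The factor 12 arises by going through `x`: `4 * 2 ^ j + 4 * 2 ^ (j + 1) = 12 * 2 ^ j`.
  have hchain := steinerCost_image_le_sum r T ψ (fun j => 12 * 2 ^ j * ε) J (by simp [ψ]) (by
    intro j hj x
    refine (dist_triangle_left _ _ x).trans ((add_le_add (hψ j hj.le x)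
      (hψ (j + 1) hj x)).trans_eq ?_)
    ring)
  have himg : T.image (ψ 0) = T := by
    rw [show ψ 0 = id from funext hψ0, Finset.image_id]
  rw [himg] at hchain
  refine hchain.trans ?_
  rw [← sum_dyadic_blocks]
  refine Finset.sum_le_sum fun j hj => ?_
  have hNj : ((T.image (ψ j)).erase r).card = N (κ j) := by
    simp only [ψ, if_pos (Finset.mem_range.mp hj), N]
  rw [hNj]
  calc 12 * 2 ^ j * ε * (N (κ j) : ℝ)
      = ∑ k ∈ Finset.Ico (2 ^ j) (2 ^ (j + 1)), 12 * ε * (N (κ j) : ℝ) := by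
        rw [Finset.sum_const, Nat.card_Ico, pow_succ, mul_two, Nat.add_sub_cancel, nsmul_eq_mul]
        push_cast
        ring
    _ ≤ _ := by
        refine Finset.sum_le_sum fun k hk => ?_
        exact mul_le_mul_of_nonneg_left (Nat.cast_le.mpr (hκmin j k hk)) (by positivity)

-- Each hit centre other than `r` is charged to its scaled indicator function, which differs between
-- a terminal and the root and so must vary along any feasible tree.
open Classical in
theorem sum_clusters_le_steinerCost {X : Type*} [Fintype X] [MetricSpace X] {n : ℕ} (r : X)
    {ε : ℝ} (hε : 0 < ε) (hmin : ∀ x y : X, x ≠ y → ε < dist x y) (s : Finset ℕ)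
    (T : Finset X) :
    ∑ π : X ≃ Fin n, ∑ k ∈ s,
      12 * ε * (((T.image (rootedCenter r π (k * ε))).erase r).card : ℝ) ≤
      Fintype.card (X ≃ Fin n) * (48 * harmonic (Fintype.card X)) *
        steinerCost r (T : Set X) := by
  let F : ℝ := Fintype.card (X ≃ Fin n)
  let H : ℝ := harmonic (Fintype.card X)
  have hF : 0 ≤ F := Nat.cast_nonneg _
  have hH : 0 ≤ H := by
    have : 0 ≤ harmonic (Fintype.card X) := Finset.sum_nonneg fun i _ => by positivity
    exact Rat.cast_nonneg.mpr this
  let φ : (X ≃ Fin n) → ℕ → X → X := fun π k => rootedCenter r π (k * ε)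
  let h : (X ≃ Fin n) × ℕ × X → X → ℝ := fun i x => if φ i.1 i.2.1 x = i.2.2 then 12 * ε else 0
  let a : (X ≃ Fin n) × ℕ × X → ℝ := fun i =>
    if i.2.2 ∈ (T.image (φ i.1 i.2.1)).erase r then 12 * ε else 0
  have main := sum_le_mul_steinerCost r (T : Set X)
    ((Finset.univ : Finset (X ≃ Fin n)) ×ˢ (s ×ˢ (Finset.univ : Finset X))) h a
    (K := F * (48 * H)) ?_ ?_
  · refine le_trans (le_of_eq ?_) main
    rw [Finset.sum_product]
    refine Finset.sum_congr rfl fun π _ => ?_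
    rw [Finset.sum_product]
    refine Finset.sum_congr rfl fun k _ => ?_
    simp only [a]
    rw [Finset.sum_ite_mem, Finset.univ_inter, Finset.sum_const, nsmul_eq_mul, mul_comm]
  · intro x y hxy
    have hd := hmin x y hxy
    rw [Finset.sum_product]
    -- A separated pair changes at most two indicators, by `12 * ε` each. The rounding term `+ 1`
    -- contributes a further factor 2, since `ε < dist x y`.
    calc _ ≤ ∑ π : X ≃ Fin n, ∑ k ∈ s, 24 * ε *
            (if ballCenter π (k * ε) x ≠ ballCenter π (k * ε) y then (1 : ℝ) else 0) := by
          refine Finset.sum_le_sum fun π _ => ?_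
          rw [Finset.sum_product]
          refine Finset.sum_le_sum fun k _ => ?_
          by_cases hφ : φ π k x = φ π k y
          · refine le_trans (le_of_eq (Finset.sum_eq_zero fun w _ => ?_)) (by positivity)
            simp [h, hφ]
          · rw [if_pos (ballCenter_ne_of_rootedCenter_ne hφ)]
            calc _ ≤ ∑ w : X, ((if φ π k x = w then 12 * ε else 0) +
                    (if φ π k y = w then 12 * ε else 0)) := by
                  refine Finset.sum_le_sum fun w _ => ?_
                  simp only [h]
                  refine (abs_sub _ _).trans (le_of_eq ?_)
                  rw [abs_of_nonneg, abs_of_nonneg] <;> positivity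
              _ ≤ _ := by
                  rw [Finset.sum_add_distrib, Finset.sum_ite_eq, Finset.sum_ite_eq]
                  simp only [Finset.mem_univ, if_true]
                  linarith
      _ = 24 * ε * ∑ π : X ≃ Fin n, ∑ k ∈ s,
            (if ballCenter π (k * ε) x ≠ ballCenter π (k * ε) y then (1 : ℝ) else 0) := by
          simp_rw [Finset.mul_sum]
      _ ≤ 24 * ε * (F * H * (dist x y / ε + 1)) := by
          gcongr
          exact sum_separated_le hε s x y
      _ = 24 * (F * H) * (dist x y + ε) := by field_simp
      _ ≤ 24 * (F * H) * (dist x y + dist x y) := by gcongr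
      _ = F * (48 * H) * dist x y := by ring
  · rintro ⟨π, k, w⟩ -
    by_cases hw : w ∈ (T.image (φ π k)).erase r
    · obtain ⟨hwr, t, ht, hφ⟩ : w ≠ r ∧ ∃ t ∈ T, φ π k t = w := by simpa using hw
      refine ⟨t, Or.inr ht, r, Or.inl rfl, ?_⟩
      have hr : φ π k r ≠ w := by
        rw [show φ π k r = r from rootedCenter_root r π _]
        exact hwr.symm
      simp only [a, h, if_pos hw, if_pos hφ, if_neg hr, sub_zero]
      exact le_abs_self _
    · exact ⟨r, Or.inl rfl, r, Or.inl rfl, by simp only [a, if_neg hw, sub_self, abs_zero, le_refl]⟩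

/-- These are the two ends of the chain: singleton clusters at radius `ε`, and every point within `2
^ J * ε` of the root. -/
theorem exists_scales {X : Type*} [Fintype X] [MetricSpace X] :
    ∃ (ε : ℝ) (J : ℕ), 0 < ε ∧ J ≠ 0 ∧ (∀ x y : X, x ≠ y → ε < dist x y) ∧
      ∀ x y : X, dist x y ≤ 2 ^ J * ε := by
  classical
  obtain ⟨ε, hε, hmin⟩ : ∃ ε : ℝ, 0 < ε ∧ ∀ x y : X, x ≠ y → ε < dist x y := by
    have h : ∀ᶠ ε : ℝ in nhdsWithin 0 (Set.Ioi 0), 0 < ε ∧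
        ∀ p : X × X, p.1 ≠ p.2 → ε < dist p.1 p.2 := by
      refine Filter.Eventually.and self_mem_nhdsWithin (Filter.eventually_all.mpr fun p => ?_)
      by_cases hp : p.1 = p.2
      · exact Filter.Eventually.of_forall fun _ h => absurd hp h
      · filter_upwards [nhdsWithin_le_nhds (Iio_mem_nhds (dist_pos.mpr hp))] with ε hε _
        exact hε
    obtain ⟨ε, h0, h1⟩ := h.exists
    exact ⟨ε, h0, fun x y => h1 (x, y)⟩
  obtain ⟨B, hB⟩ := (Set.finite_range fun p : X × X => dist p.1 p.2).bddAbove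
  obtain ⟨J, hJ⟩ := pow_unbounded_of_one_lt (B / ε) (one_lt_two (α := ℝ))
  refine ⟨ε, J + 1, hε, J.succ_ne_zero, hmin, fun x y => ?_⟩
  have h1 : dist x y ≤ B := hB ⟨(x, y), rfl⟩
  have h2 : (2 : ℝ) ^ J ≤ 2 ^ (J + 1) := pow_le_pow_right₀ one_le_two J.le_succ
  rw [div_lt_iff₀ hε] at hJ
  nlinarith

/-- Steiner tree cost is approximated within a logarithmic factor by a submodular function. -/
theorem isSubmodularApprox_harmonic {X : Type*} [Fintype X] [MetricSpace X] (r : X) :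
    IsSubmodularApprox (fun T : Set X => steinerCost r T)
      (48 * harmonic (Fintype.card X)) := by
  classical
  obtain ⟨ε, J, hε, hJ0, hmin, hJ⟩ := exists_scales (X := X)
  let n := Fintype.card X
  let F : ℝ := Fintype.card (X ≃ Fin n)
  have hF : 0 < F := Nat.cast_pos.mpr (Fintype.card_pos_iff.mpr ⟨Fintype.equivFin X⟩)
  let N : (X ≃ Fin n) → ℕ → Finset X → ℕ := fun π k T =>
    ((T.image (rootedCenter r π (k * ε))).erase r).card
  let g : Set X → ℝ := fun T =>
    F⁻¹ * ∑ π : X ≃ Fin n, ∑ k ∈ Finset.Ico 1 (2 ^ J), 12 * ε * (N π k T.toFinset : ℝ)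
  refine ⟨g, ?_, fun S => ⟨?_, ?_⟩⟩
  · intro A B
    simp only [g]
    rw [← mul_add, ← mul_add, ← Finset.sum_add_distrib, ← Finset.sum_add_distrib]
    refine mul_le_mul_of_nonneg_left (Finset.sum_le_sum fun π _ => ?_) (by positivity)
    rw [← Finset.sum_add_distrib, ← Finset.sum_add_distrib]
    refine Finset.sum_le_sum fun k _ => ?_
    rw [← mul_add, ← mul_add]
    refine mul_le_mul_of_nonneg_left ?_ (by positivity)
    rw [Set.toFinset_union, Set.toFinset_inter]
    exact_mod_cast card_image_erase_submodular _ r A.toFinset B.toFinset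
  · simp only [g]
    rw [le_inv_mul_iff₀ hF]
    calc F * steinerCost r S = ∑ _π : X ≃ Fin n, steinerCost r (S.toFinset : Set X) := by
          simp [F]
      _ ≤ _ := Finset.sum_le_sum fun π _ =>
          steinerCost_le_sum_clusters r π hε hmin hJ0 hJ S.toFinset
  · simp only [g]
    rw [inv_mul_le_iff₀ hF, ← mul_assoc]
    have := sum_clusters_le_steinerCost (n := n) r hε hmin (Finset.Ico 1 (2 ^ J)) S.toFinset
    rwa [Set.coe_toFinset] at this

theorem submodularityGap_le_of_approx {X : Type*} {f : Set X → ℝ} {lam : ℝ} (h0 : 0 ≤ lam)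
    (h : IsSubmodularApprox f lam) : submodularityGap f ≤ ENNReal.ofReal lam := by
  refine iInf₂_le_of_le lam.toNNReal ?_ le_rfl
  rwa [Real.coe_toNNReal _ h0]

theorem steinerTreeGap_le {n : ℕ} (hn : 2 ≤ n) :
    steinerTreeGap n ≤ ENNReal.ofReal (144 * Real.log n) := by
  refine iSup_le fun X => iSup_le fun hX => iSup_le fun hM => iSup_le fun hc => iSup_le fun r => ?_
  have hH : 0 ≤ harmonic (Fintype.card X) := Finset.sum_nonneg fun i _ => by positivity
  refine (submodularityGap_le_of_approx (mul_nonneg (by norm_num) (by exact_mod_cast hH))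
    (isSubmodularApprox_harmonic r)).trans (ENNReal.ofReal_le_ofReal ?_)
  have h1 := harmonic_le_one_add_log (Fintype.card X)
  have h2 : Real.log 2 ≤ Real.log n := Real.log_le_log two_pos (by exact_mod_cast hn)
  rw [hc] at h1 ⊢
  -- `48 * (1 + log n) ≤ 144 * log n` since `1 ≤ 2 * log 2`.
  linarith [Real.log_two_gt_d9]

/-! ### Packing lower bound for Steiner cost -/

/-- The cap of radius `δ` around `q`. -/
noncomputable def cap {X : Type*} [MetricSpace X] (δ : ℝ) (q x : X) : ℝ := max 0 (δ - dist x q)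

theorem abs_cap_sub_le {X : Type*} [MetricSpace X] (δ : ℝ) (q x y : X) :
    |cap δ q x - cap δ q y| ≤ dist x y := by
  have h1 := dist_triangle x y q
  have h2 := dist_triangle_left y q x
  have h3 := dist_nonneg (x := x) (y := y)
  rw [abs_le]
  unfold cap
  constructor
  · rcases max_cases 0 (δ - dist x q) with h | h <;>
      rcases max_cases 0 (δ - dist y q) with h' | h' <;> linarith
  · rcases max_cases 0 (δ - dist x q) with h | h <;>
      rcases max_cases 0 (δ - dist y q) with h' | h' <;> linarith

theorem exists_cap_eq_zero {X ι : Type*} [MetricSpace X] {δ : ℝ} {P : Finset ι}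
    (hP : P.Nonempty) (q : ι → X)
    (hsep : ∀ i ∈ P, ∀ j ∈ P, i ≠ j → 2 * δ ≤ dist (q i) (q j)) (x : X) :
    ∃ i₀ ∈ P, ∀ i ∈ P, i ≠ i₀ → cap δ (q i) x = 0 := by
  by_cases h : ∃ i₀ ∈ P, dist x (q i₀) < δ
  · obtain ⟨i₀, hi₀, hx⟩ := h
    refine ⟨i₀, hi₀, fun i hi hne => max_eq_left ?_⟩
    linarith [hsep i hi i₀ hi₀ hne, dist_triangle_left (q i) (q i₀) x]
  · push Not at h
    obtain ⟨i₀, hi₀⟩ := hP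
    exact ⟨i₀, hi₀, fun i hi _ => max_eq_left (sub_nonpos.mpr (h i hi))⟩

/-- Each of `x` and `y` meets at most one cap. If these differ and both values are positive, they
add up to `2 * δ - dist x (q i) - dist y (q j)`, which is at most `dist x y` by separation. -/
theorem sum_abs_cap_sub_le {X ι : Type*} [MetricSpace X] {δ : ℝ} {P : Finset ι}
    (hP : P.Nonempty) (q : ι → X)
    (hsep : ∀ i ∈ P, ∀ j ∈ P, i ≠ j → 2 * δ ≤ dist (q i) (q j)) (x y : X) :
    ∑ i ∈ P, |cap δ (q i) x - cap δ (q i) y| ≤ dist x y := by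
  obtain ⟨i, hi, hx⟩ := exists_cap_eq_zero hP q hsep x
  obtain ⟨j, hj, hy⟩ := exists_cap_eq_zero hP q hsep y
  by_cases hij : i = j
  · subst hij
    rw [Finset.sum_eq_single_of_mem i hi fun l hl hne => by simp [hx l hl hne, hy l hl hne]]
    exact abs_cap_sub_le _ _ _ _
  · rw [Finset.sum_eq_add_of_mem i j hi hj hij fun l hl hne => by
      simp [hx l hl hne.1, hy l hl hne.2]]
    have h1 := abs_cap_sub_le δ (q i) x y
    have h2 := abs_cap_sub_le δ (q j) x y
    rw [hy i hi hij, sub_zero, abs_of_nonneg (le_max_left _ _)] at h1 ⊢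
    rw [hx j hj (Ne.symm hij), zero_sub, abs_neg, abs_of_nonneg (le_max_left _ _)] at h2 ⊢
    have h3 := hsep i hi j hj hij
    have h4 := dist_triangle_left (q i) (q j) x
    have h5 := dist_triangle x y (q j)
    unfold cap at h1 h2 ⊢
    rcases max_cases 0 (δ - dist x (q i)) with h | h <;>
      rcases max_cases 0 (δ - dist y (q j)) with h' | h' <;> linarith

/-- Steiner trees spanning many well separated points are long. -/
theorem card_mul_le_steinerCost {X ι : Type*} [Fintype X] [MetricSpace X] (r : X) (T : Set X)
    {δ : ℝ} {P : Finset ι} (hP : 1 < P.card) (q : ι → X) (hq : ∀ i ∈ P, q i ∈ T)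
    (hsep : ∀ i ∈ P, ∀ j ∈ P, i ≠ j → 2 * δ ≤ dist (q i) (q j)) :
    P.card * δ ≤ steinerCost r T := by
  have h := sum_le_mul_steinerCost r T P (fun i => cap δ (q i)) (fun _ => δ) (K := 1)
    (fun x y _ => by
      rw [one_mul]
      exact sum_abs_cap_sub_le (Finset.card_pos.mp (by omega)) q hsep x y)
    (fun i hi => by
      obtain ⟨j, hj, hne⟩ := Finset.exists_mem_ne hP i
      refine ⟨q i, Or.inr (hq i hi), q j, Or.inr (hq j hj), ?_⟩
      have h1 : cap δ (q i) (q i) ≥ δ := by simp [cap]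
      have h2 : cap δ (q i) (q j) ≤ 0 ∨ δ ≤ 0 := by
        by_cases hδ : δ ≤ 0
        · exact Or.inr hδ
        · refine Or.inl (max_le le_rfl ?_)
          linarith [hsep j hj i hi hne]
      rcases h2 with h2 | h2
      · exact le_trans (by linarith) (le_abs_self _)
      · exact h2.trans (abs_nonneg _))
  simpa using h

/-! ### Lower bound for diamonds -/

/-- Coordinates for the vertices of the diamond graph of depth `k`: the position `p` on a path from
`0` to `2 ^ k` and the path `b`, read modulo `2 ^ j` on level `j`. Consecutive vertices on a path
are at distance at most `1`. -/
structure IsDiamond {Y : Type*} [MetricSpace Y] (k : ℕ) (Φ : ℕ → ℕ → Y) : Prop where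
  dist_succ : ∀ p b, p < 2 ^ k → dist (Φ (p + 1) b) (Φ p b) ≤ 1
  congr_path : ∀ i ≤ k, ∀ p b b', 2 ^ (k - i) ∣ p → b ≡ b' [MOD 2 ^ i] → Φ p b = Φ p b'
  dist_position : ∀ p : ℕ, p ≤ 2 ^ k → ∀ p' : ℕ, p' ≤ 2 ^ k → ∀ b b', |(p : ℝ) - p'| ≤ dist (Φ p b) (Φ p' b')
  dist_path : ∀ i < k, ∀ a < 2 ^ i, ∀ b b', ¬ b ≡ b' [MOD 2 ^ (i + 1)] →
    2 ^ (k - (i + 1)) ≤ dist (Φ (2 ^ (k - (i + 1)) * (2 * a + 1)) b)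
      (Φ (2 ^ (k - (i + 1)) * (2 * a + 1)) b')

/-- The vertices of the diamond on the paths that continue `β` after the first `i` levels. -/
def diamondPaths {Y : Type*} (k : ℕ) (Φ : ℕ → ℕ → Y) (i β : ℕ) : Set Y :=
  {y | ∃ p ≤ 2 ^ k, ∃ b, b / 2 ^ i = β ∧ Φ p b = y}

theorem diamondPaths_succ {Y : Type*} (k : ℕ) (Φ : ℕ → ℕ → Y) (i β : ℕ) :
    diamondPaths k Φ (i + 1) β = diamondPaths k Φ i (2 * β) ∪ diamondPaths k Φ i (2 * β + 1) := by
  have hb : ∀ b : ℕ, b / 2 ^ (i + 1) = β ↔ b / 2 ^ i = 2 * β ∨ b / 2 ^ i = 2 * β + 1 := by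
    intro b
    rw [pow_succ, ← Nat.div_div_eq_div_mul]
    omega
  ext y
  constructor
  · rintro ⟨p, hp, b, h, rfl⟩
    rcases (hb b).mp h with h | h
    · exact Or.inl ⟨p, hp, b, h, rfl⟩
    · exact Or.inr ⟨p, hp, b, h, rfl⟩
  · rintro (⟨p, hp, b, h, rfl⟩ | ⟨p, hp, b, h, rfl⟩)
    · exact ⟨p, hp, b, (hb b).mpr (Or.inl h), rfl⟩
    · exact ⟨p, hp, b, (hb b).mpr (Or.inr h), rfl⟩

namespace IsDiamond

variable {Y : Type*} [MetricSpace Y] {k : ℕ} {Φ : ℕ → ℕ → Y}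

/-- The depth-`i` vertices see only the low `i` bits of the path, so they belong to every bundle
`β`. -/
theorem mem_diamondPaths (h : IsDiamond k Φ) {i : ℕ} (hi : i ≤ k) (β : ℕ) {p c : ℕ}
    (hp : p ≤ 2 ^ k) (hdvd : 2 ^ (k - i) ∣ p) (hc : c < 2 ^ i) :
    Φ p c ∈ diamondPaths k Φ i β := by
  refine ⟨p, hp, 2 ^ i * β + c, ?_, ?_⟩
  · rw [Nat.mul_add_div (by positivity), Nat.div_eq_of_lt hc, add_zero]
  · refine h.congr_path i hi p _ _ hdvd ?_
    simp [Nat.ModEq]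

variable [Fintype Y]

/-- For `i > 0` the odd multiples of `2 ^ (k - i)` give `2 ^ (i - 1)` positions with `2 ^ i`
vertices each, pairwise `2 ^ (k - i)` apart; packing with half that radius gives the bound. For `i =
0` the two ends suffice. -/
theorem le_steinerCost (h : IsDiamond k Φ) {i : ℕ} (hi : i ≤ k) (r : Y) {T : Set Y}
    (hT : ∀ p ≤ 2 ^ k, 2 ^ (k - i) ∣ p → ∀ c < 2 ^ i, Φ p c ∈ T) :
    (2 : ℝ) ^ (k + i) / 4 ≤ steinerCost r T := by
  rcases i with _ | i
  · have hle : ∀ a ∈ Finset.range 2, 2 ^ k * a ≤ 2 ^ k := fun a ha =>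
      mul_le_of_le_one_right' (Nat.lt_succ_iff.mp (Finset.mem_range.mp ha))
    have h1 := card_mul_le_steinerCost r T (δ := 2 ^ k / 2) (P := Finset.range 2) (by simp)
      (fun a => Φ (2 ^ k * a) 0) (fun a ha => hT _ (hle a ha) (by simp) 0 (by simp))
      (by
        intro a ha a' ha' hne
        refine le_trans ?_ (h.dist_position _ (hle a ha) _ (hle a' ha') _ _)
        have h2 : (1 : ℤ) ≤ |(a : ℤ) - a'| := Int.one_le_abs (by omega)
        push_cast
        rw [mul_div_cancel₀ _ two_ne_zero, ← mul_sub, abs_mul, abs_of_pos (by positivity)]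
        exact le_mul_of_one_le_right (by positivity) (by exact_mod_cast h2))
    refine le_trans ?_ h1
    simp only [Finset.card_range, Nat.cast_ofNat, add_zero]
    linarith [show (0 : ℝ) < 2 ^ k by positivity]
  · obtain ⟨m, rfl⟩ : ∃ m, k = m + (i + 1) := ⟨k - (i + 1), by omega⟩
    have hm : m + (i + 1) - (i + 1) = m := by omega
    have hpos : ∀ a < 2 ^ i, 2 ^ m * (2 * a + 1) ≤ 2 ^ (m + (i + 1)) := by
      intro a ha
      rw [pow_add, pow_succ]
      exact Nat.mul_le_mul_left _ (by omega)
    have h1 := card_mul_le_steinerCost r T (δ := 2 ^ m / 2)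
      (P := Finset.range (2 ^ i) ×ˢ Finset.range (2 ^ (i + 1)))
      (by
        rw [Finset.card_product, Finset.card_range, Finset.card_range, pow_succ]
        nlinarith [Nat.one_le_two_pow (n := i)])
      (fun ac => Φ (2 ^ m * (2 * ac.1 + 1)) ac.2)
      (by
        rintro ⟨a, c⟩ hac
        simp only [Finset.mem_product, Finset.mem_range] at hac
        exact hT _ (hpos a hac.1) (by rw [hm]; exact dvd_mul_right _ _) c hac.2)
      (by
        rintro ⟨a, c⟩ hac ⟨a', c'⟩ hac' hne
        simp only [Finset.mem_product, Finset.mem_range] at hac hac'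
        rw [mul_div_cancel₀ _ two_ne_zero]
        by_cases haa : a = a'
        · subst haa
          have := h.dist_path i (by omega) a hac.1 c c' (fun hmod => hne (by
            rw [Nat.ModEq, Nat.mod_eq_of_lt hac.2, Nat.mod_eq_of_lt hac'.2] at hmod
            rw [hmod]))
          rwa [hm] at this
        · refine le_trans ?_ (h.dist_position _ (hpos a hac.1) _ (hpos a' hac'.1) _ _)
          push_cast
          rw [← mul_sub, abs_mul, abs_of_pos (by positivity)]
          refine le_mul_of_one_le_right (by positivity) ?_
          have h2 : (1 : ℤ) ≤ |(2 * a + 1 : ℤ) - (2 * a' + 1)| :=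
            Int.one_le_abs (by omega)
          exact_mod_cast h2)
    refine le_trans (le_of_eq ?_) h1
    rw [Finset.card_product, Finset.card_range, Finset.card_range]
    push_cast
    ring

theorem steinerCost_path_le (h : IsDiamond k Φ) (β : ℕ) :
    steinerCost (Φ 0 0) (diamondPaths k Φ 0 β) ≤ 2 ^ k := by
  have key : ∀ m ≤ 2 ^ k, steinerCost (Φ 0 0) {y | ∃ p ≤ m, Φ p β = y} ≤ m := by
    intro m
    induction m with
    | zero =>
      intro _
      rw [steinerCost_subset_root]
      · simp
      · rintro y ⟨p, hp, rfl⟩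
        rw [Nat.le_zero.mp hp]
        exact h.congr_path 0 (Nat.zero_le k) 0 _ _ (dvd_zero _) (by simp [Nat.modEq_one])
    | succ m ih =>
      intro hm
      have h1 := steinerCost_insert_le (Φ 0 0) (T := {y | ∃ p ≤ m, Φ p β = y}) (Φ (m + 1) β)
        (y := Φ m β) (Or.inr ⟨m, le_rfl, rfl⟩)
      have h2 : steinerCost (Φ 0 0) {y | ∃ p ≤ m + 1, Φ p β = y} ≤
          steinerCost (Φ 0 0) (insert (Φ (m + 1) β) {y | ∃ p ≤ m, Φ p β = y}) := by
        refine steinerCost_mono _ ?_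
        rintro y ⟨p, hp, rfl⟩
        rcases hp.lt_or_eq with hp | rfl
        · exact Or.inr ⟨p, by omega, rfl⟩
        · exact Or.inl rfl
      have := ih (by omega)
      have := h.dist_succ m β hm
      push_cast
      linarith
  have := key _ le_rfl
  push_cast at this
  refine (steinerCost_mono _ ?_).trans this
  rintro y ⟨p, hp, b, hb, rfl⟩
  rw [pow_zero, Nat.div_one] at hb
  exact ⟨p, hp, by rw [hb]⟩

/-- This covers small depths, where `k / 8` says little or nothing. -/
theorem one_le_of_approx (h : IsDiamond k Φ) {lam : ℝ}
    (happ : IsSubmodularApprox (fun T : Set Y => steinerCost (Φ 0 0) T) lam) : 1 ≤ lam := by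
  obtain ⟨g, -, hg⟩ := happ
  have h1 := h.le_steinerCost (Nat.zero_le k) (Φ 0 0) (T := Set.univ) fun _ _ _ _ _ => trivial
  have hpos : 0 < steinerCost (Φ 0 0) Set.univ := lt_of_lt_of_le (by positivity) h1
  exact (le_mul_iff_one_le_left hpos).mp ((hg Set.univ).1.trans (hg Set.univ).2)

theorem depth_le_of_approx (h : IsDiamond k Φ) {lam : ℝ} (h0 : 0 ≤ lam)
    (happ : IsSubmodularApprox (fun T : Set Y => steinerCost (Φ 0 0) T) lam) :
    (k : ℝ) / 8 ≤ lam := by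
  obtain ⟨g, hsub, hg⟩ := happ
  -- Merging two bundles saves `2 ^ (k + i) / 4`, which is `1 / 8` in units of the new scale `2 ^ (k
  -- + i + 1)`.
  have key : ∀ i ≤ k, ∀ β,
      g (diamondPaths k Φ i β) ≤ 2 ^ i * (2 ^ k * (lam - i / 8)) := by
    intro i
    induction i with
    | zero =>
      intro _ β
      have := mul_le_mul_of_nonneg_left (h.steinerCost_path_le β) h0
      have := (hg (diamondPaths k Φ 0 β)).2
      simp only [pow_zero, Nat.cast_zero]
      linarith
    | succ i ih =>
      intro hi β
      have h1 := ih (by omega) (2 * β)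
      have h2 := ih (by omega) (2 * β + 1)
      have h3 := hsub (diamondPaths k Φ i (2 * β)) (diamondPaths k Φ i (2 * β + 1))
      have h4 := (hg (diamondPaths k Φ i (2 * β) ∩ diamondPaths k Φ i (2 * β + 1))).1
      have h5 := h.le_steinerCost (i := i) (by omega) (Φ 0 0)
        (T := diamondPaths k Φ i (2 * β) ∩ diamondPaths k Φ i (2 * β + 1))
        fun p hp hd c hc => ⟨h.mem_diamondPaths (by omega) _ hp hd hc,
          h.mem_diamondPaths (by omega) _ hp hd hc⟩
      rw [diamondPaths_succ]
      rw [pow_add] at h5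
      have h6 : (2 : ℝ) ^ (i + 1) * (2 ^ k * (lam - ((i + 1 : ℕ) : ℝ) / 8)) =
          2 * (2 ^ i * (2 ^ k * (lam - i / 8))) - 2 ^ k * 2 ^ i / 4 := by
        push_cast
        ring
      rw [h6]
      linarith
  have h1 := key k le_rfl 0
  have h2 := (hg (diamondPaths k Φ k 0)).1
  have h3 := steinerCost_nonneg (Φ 0 0) (diamondPaths k Φ k 0)
  have h4 : (0 : ℝ) ≤ 2 ^ k * (2 ^ k * (lam - k / 8)) := h3.trans (h2.trans h1)
  have h5 := nonneg_of_mul_nonneg_right (nonneg_of_mul_nonneg_right h4 (by positivity))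
    (by positivity)
  linarith

end IsDiamond

/-! ### Realising the diamond in a sup-norm space -/

/-- The distance from `p` to the nearest multiple of `m`. -/
def distMultiple (p m : ℕ) : ℕ := min (p % m) (m - p % m)

theorem distMultiple_of_dvd {p m : ℕ} (h : m ∣ p) : distMultiple p m = 0 := by
  simp [distMultiple, Nat.mod_eq_zero_of_dvd h]

theorem distMultiple_of_le_half {p m : ℕ} (hm : 0 < m) (h : 2 * p ≤ m) :
    distMultiple p m = p := by
  rw [distMultiple, Nat.mod_eq_of_lt (by omega)]
  omega

theorem distMultiple_odd (q a : ℕ) : distMultiple (q * (2 * a + 1)) (2 * q) = q := by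
  rcases Nat.eq_zero_or_pos q with rfl | hq
  · simp [distMultiple]
  · rw [distMultiple, show q * (2 * a + 1) = q + 2 * q * a by ring, Nat.add_mul_mod_self_left,
      Nat.mod_eq_of_lt (by omega)]
    omega

theorem abs_distMultiple_succ_sub_le {m : ℕ} (hm : 0 < m) (p : ℕ) :
    |(distMultiple (p + 1) m : ℝ) - distMultiple p m| ≤ 1 := by
  have h : distMultiple (p + 1) m ≤ distMultiple p m + 1 ∧
      distMultiple p m ≤ distMultiple (p + 1) m + 1 := by
    have hlt := Nat.mod_lt p hm
    have hmod : (p + 1) % m = (p % m + 1) % m := (Nat.mod_add_mod p m 1).symm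
    unfold distMultiple
    rcases (show p % m + 1 ≤ m from hlt).lt_or_eq with hs | hs
    · rw [hmod, Nat.mod_eq_of_lt hs]
      omega
    · rw [hmod, hs, Nat.mod_self]
      omega
  have h1 : (distMultiple (p + 1) m : ℝ) ≤ distMultiple p m + 1 := by exact_mod_cast h.1
  have h2 : (distMultiple p m : ℝ) ≤ distMultiple (p + 1) m + 1 := by exact_mod_cast h.2
  rw [abs_le]
  constructor <;> linarith

/-- Coordinates of the vertex at position `p` of the path `b` in the diamond of depth `k`. -/
def diamondPoint (k p b : ℕ) : Fin (k + 1) × Fin (2 ^ k) → ℝ := fun jc =>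
  if b ≡ jc.2 [MOD 2 ^ (jc.1 : ℕ)] then distMultiple p (2 ^ (k + 1 - jc.1)) else 0

theorem diamondPoint_congr {k i : ℕ} (hi : i ≤ k) {p b b' : ℕ} (hp : 2 ^ (k - i) ∣ p)
    (hb : b ≡ b' [MOD 2 ^ i]) : diamondPoint k p b = diamondPoint k p b' := by
  funext ⟨j, c⟩
  unfold diamondPoint
  dsimp only
  rcases le_or_gt (j : ℕ) i with hj | hj
  · have h : b ≡ b' [MOD 2 ^ (j : ℕ)] := hb.of_dvd (pow_dvd_pow 2 hj)
    have h' : b ≡ c [MOD 2 ^ (j : ℕ)] ↔ b' ≡ c [MOD 2 ^ (j : ℕ)] :=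
      ⟨fun h1 => h.symm.trans h1, fun h1 => h.trans h1⟩
    simp only [h']
  · rw [distMultiple_of_dvd ((pow_dvd_pow 2 (by omega)).trans hp)]
    simp

theorem dist_diamondPoint_succ_le (k p b : ℕ) :
    dist (diamondPoint k (p + 1) b) (diamondPoint k p b) ≤ 1 := by
  refine (dist_pi_le_iff zero_le_one).mpr fun jc => ?_
  rw [Real.dist_eq]
  unfold diamondPoint
  split_ifs
  · exact abs_distMultiple_succ_sub_le (by positivity) p
  · simp

/-- Level `0` ignores the path and has modulus `2 ^ (k + 1)`, so its coordinate is the position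
itself. -/
theorem abs_sub_le_dist_diamondPoint {k p p' : ℕ} (hp : p ≤ 2 ^ k) (hp' : p' ≤ 2 ^ k)
    (b b' : ℕ) : |(p : ℝ) - p'| ≤ dist (diamondPoint k p b) (diamondPoint k p' b') := by
  have h := dist_le_pi_dist (diamondPoint k p b) (diamondPoint k p' b')
    (⟨0, by omega⟩, ⟨0, by positivity⟩)
  have hh : ∀ q ≤ 2 ^ k, distMultiple q (2 ^ (k + 1)) = q := fun q hq =>
    distMultiple_of_le_half (by positivity) (by rw [pow_succ]; omega)
  simpa [diamondPoint, Nat.modEq_one, hh p hp, hh p' hp', Real.dist_eq] using h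

/-- The level `i + 1` coordinate indexed by `b` vanishes on `b'`; on `b` it takes its peak value, as
the position is halfway between multiples of the modulus. -/
theorem le_dist_diamondPoint {k i : ℕ} (hi : i < k) (a : ℕ) {b b' : ℕ}
    (hb : ¬ b ≡ b' [MOD 2 ^ (i + 1)]) :
    2 ^ (k - (i + 1)) ≤ dist (diamondPoint k (2 ^ (k - (i + 1)) * (2 * a + 1)) b)
      (diamondPoint k (2 ^ (k - (i + 1)) * (2 * a + 1)) b') := by
  have h := dist_le_pi_dist (diamondPoint k (2 ^ (k - (i + 1)) * (2 * a + 1)) b)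
    (diamondPoint k (2 ^ (k - (i + 1)) * (2 * a + 1)) b')
    (⟨i + 1, by omega⟩, ⟨b % 2 ^ k, Nat.mod_lt _ (by positivity)⟩)
  have h1 : b % 2 ^ k ≡ b [MOD 2 ^ (i + 1)] :=
    (Nat.mod_modEq b (2 ^ k)).of_dvd (pow_dvd_pow 2 hi)
  have h2 : ¬ b' ≡ b % 2 ^ k [MOD 2 ^ (i + 1)] := fun h' => hb (h'.trans h1).symm
  have h3 : 2 ^ (k + 1 - (i + 1)) = 2 * 2 ^ (k - (i + 1)) := by
    rw [← pow_succ']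
    congr 1
    omega
  simpa only [diamondPoint, if_pos h1.symm, if_neg h2, h3, distMultiple_odd, Real.dist_eq,
    sub_zero, Nat.cast_pow, Nat.cast_ofNat, abs_pow, Nat.abs_ofNat] using h

/-- Every large enough size is the size of a metric space containing a diamond. -/
theorem exists_isDiamond {k n : ℕ} (hn : 2 ^ (2 * k + 1) ≤ n) :
    ∃ (Y : Type) (_ : Fintype Y) (_ : MetricSpace Y) (Φ : ℕ → ℕ → Y),
      Fintype.card Y = n ∧ IsDiamond k Φ := by
  classical
  let V := Fin (k + 1) × Fin (2 ^ k) → ℝ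
  have : Nonempty (Fin (2 ^ k)) := ⟨⟨0, by positivity⟩⟩
  let s : Finset V := (Finset.range (2 ^ k + 1) ×ˢ Finset.range (2 ^ k)).image
    fun pb => diamondPoint k pb.1 pb.2
  have hs : s.card ≤ n := by
    refine Finset.card_image_le.trans (le_trans ?_ hn)
    rw [Finset.card_product, Finset.card_range, Finset.card_range, pow_succ, two_mul, pow_add]
    nlinarith [Nat.one_le_two_pow (n := k)]
  -- Arbitrary further points of the ambient space bring the cardinality to exactly `n`.
  obtain ⟨t, hst, ht⟩ := Infinite.exists_superset_card_eq s n hs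
  -- Positions are clamped at `2 ^ k` because `Φ` must be defined for all `p`.
  have hmem : ∀ p b, diamondPoint k (min p (2 ^ k)) b ∈ t := by
    intro p b
    refine hst (Finset.mem_image.mpr ⟨(min p (2 ^ k), b % 2 ^ k), ?_, ?_⟩)
    · simp only [Finset.mem_product, Finset.mem_range]
      exact ⟨by omega, Nat.mod_lt _ (by positivity)⟩
    · exact diamondPoint_congr le_rfl (by simp) (Nat.mod_modEq b _)
  refine ⟨t, inferInstance, inferInstance, fun p b => ⟨_, hmem p b⟩, by simpa using ht, ?_⟩
  refine ⟨fun p b hp => ?_, fun i hi p b b' hp hb => ?_, fun p hp p' hp' b b' => ?_,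
    fun i hi a ha b b' hb => ?_⟩
  · rw [Subtype.dist_eq]
    dsimp only
    rw [min_eq_left (by omega), min_eq_left hp.le]
    exact dist_diamondPoint_succ_le k p b
  · refine Subtype.ext (diamondPoint_congr hi ?_ hb)
    rcases min_choice p (2 ^ k) with h | h <;> rw [h]
    · exact hp
    · exact pow_dvd_pow 2 (Nat.sub_le k i)
  · rw [Subtype.dist_eq]
    dsimp only
    rw [min_eq_left hp, min_eq_left hp']
    exact abs_sub_le_dist_diamondPoint hp hp' b b'
  · rw [Subtype.dist_eq]
    dsimp only
    rw [min_eq_left]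
    · exact le_dist_diamondPoint hi a hb
    · calc 2 ^ (k - (i + 1)) * (2 * a + 1) ≤ 2 ^ (k - (i + 1)) * 2 ^ (i + 1) := by
            rw [pow_succ 2 i]
            exact Nat.mul_le_mul_left _ (by omega)
        _ = 2 ^ k := by rw [← pow_add, Nat.sub_add_cancel hi]

/-! ### Conclusion -/

theorem le_steinerTreeGap {n : ℕ} (hn : 2 ≤ n) :
    ENNReal.ofReal (1 / 32 * Real.log n) ≤ steinerTreeGap n := by
  obtain ⟨k, hk⟩ : ∃ k, k = (Nat.log 2 n - 1) / 2 := ⟨_, rfl⟩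
  have hlog : 1 ≤ Nat.log 2 n := Nat.log_pos one_lt_two hn
  have h1 : 2 ^ (2 * k + 1) ≤ n :=
    (Nat.pow_le_pow_right two_pos (by omega)).trans (Nat.pow_log_le_self 2 (by omega))
  have h2 : n ≤ 2 ^ (2 * k + 3) :=
    (Nat.lt_pow_succ_log_self one_lt_two n).le.trans (Nat.pow_le_pow_right two_pos (by omega))
  obtain ⟨Y, hY, hM, Φ, hcard, hΦ⟩ := exists_isDiamond h1
  have hgap : submodularityGap (fun T : Set Y => steinerCost (Φ 0 0) T) ≤ steinerTreeGap n :=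
    le_iSup_of_le Y (le_iSup_of_le hY (le_iSup_of_le hM (le_iSup_of_le hcard
      (le_iSup_of_le (Φ 0 0) le_rfl))))
  refine le_trans (le_iInf₂ fun lam hlam => ?_) hgap
  rw [← ENNReal.ofReal_coe_nnreal]
  refine ENNReal.ofReal_le_ofReal ?_
  have h3 := hΦ.one_le_of_approx hlam
  have h4 := hΦ.depth_le_of_approx lam.coe_nonneg hlam
  -- With `log n ≤ 2 * k + 3`, the bounds `1 ≤ lam` and `k / 8 ≤ lam` together give the constant `1
  -- / 32`.
  have h5 : Real.log n ≤ (2 * k + 3) * Real.log 2 := by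
    have : Real.log n ≤ Real.log ((2 : ℝ) ^ (2 * k + 3)) :=
      Real.log_le_log (by positivity) (by exact_mod_cast h2)
    rw [Real.log_pow] at this
    exact_mod_cast this
  have h6 : (2 * (k : ℝ) + 3) * Real.log 2 ≤ 2 * k + 3 :=
    mul_le_of_le_one_right (by positivity) (by linarith [Real.log_two_lt_d9])
  linarith

theorem mainTheorem1 :
    ∃ c C : ℝ, 0 < c ∧ 0 < C ∧ ∀ n : ℕ, 2 ≤ n →
      ENNReal.ofReal (c * Real.log n) ≤ steinerTreeGap n ∧
      steinerTreeGap n ≤ ENNReal.ofReal (C * Real.log n) :=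
  ⟨1 / 32, 144, by norm_num, by norm_num, fun _ hn => ⟨le_steinerTreeGap hn, steinerTreeGap_le hn⟩⟩
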